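/- All $G$-sets are non-empty. For a group $G$, the Fitting subgroup $\mathrm{Fit}(G)$ is the subgroup generated by all nilpotent normal subgroups of $G$, and the Fitting series is defined by $F_0(G)=\{1\}$ and $F_{i+1}(G)/F_i(G)=\mathrm{Fit}(G/F_i(G))$. A pair $(g_1,g_2)\in G^2$ is \emph{non-foldable} if for every faithful $G$-set $X$ and every $n\ge 1$ there is a point $x\in X$ such that the map $[-n,n]^2\cap\mathbb{Z}^2\to X$, $(n_1,n_2)\mapsto g_2^{n_2}g_1^{n_1}x$, is injective. If $G$ is finitely generated, $S$ is a finite generating set and $X$ is a $G$-set, the growth $\mathrm{vol}_{G,X}(n)$ of the action is the supremum over $x\in X$ of the cardinality of the ball of radius $n$ around $x$ in the Schreier graph, which has vertex set $X$ and an edge between $x$ and $sx$ for all $x\in X$, $s\in S$. For $f,g\colon\mathbb{N}\to[0,\infty)$, write $f\preccurlyeq g$ if there is an integer $C>0$ with $f(n)\le C\,g(Cn)$ for all $n$. A finitely generated group $G$ has a \emph{Schreier growth gap} $f(n)$ if $f\preccurlyeq \mathrm{vol}_{G,X}$ for every faithful $G$-set $X$ (and every finite generating set $S$; the condition does not depend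 on the choice of $S$). \textbf{Theorem.} Let $G$ be a finitely generated solvable group such that all successive quotients $F_{i+1}(G)/F_i(G)$, $i\ge 0$, of the Fitting series of $G$ are torsion-free (that is, have no non-trivial element of finite order), and suppose that $G$ is not virtually abelian (has no abelian subgroup of finite index). Then there exist $g_1,g_2\in G$ such that the pair $(g_1,g_2)$ is non-foldable. In particular, $G$ has a Schreier growth gap $n^2$. -/

import Mathlib

open scoped ENNReal NNReal

universe u v

/-- The Fitting subgroup: the subgroup generated by all nilpotent normal subgroups. -/
def fittingSubgroup (G : Type u) [Group G] : Subgroup G :=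
  sSup {N : Subgroup G | N.Normal ∧ Group.IsNilpotent N}

instance fittingSubgroup_normal (G : Type u) [Group G] : (fittingSubgroup G).Normal := by
  rw [fittingSubgroup, sSup_eq_iSup]
  exact Subgroup.biSup_normal _ _ fun N hN => hN.1

/-- The Fitting series, together with the proof that each of its terms is normal:
`F 0 = 1`, and `F (i + 1)` is the preimage in `G` of the Fitting subgroup of `G ⧸ F i`. -/
def fittingSeriesAux (G : Type u) [Group G] : ℕ → {H : Subgroup G // H.Normal}
  | 0 => ⟨⊥, inferInstance⟩
  | i + 1 =>
    haveI : (fittingSeriesAux G i).1.Normal := (fittingSeriesAux G i).2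
    ⟨(fittingSubgroup (G ⧸ (fittingSeriesAux G i).1)).comap
      (QuotientGroup.mk' (fittingSeriesAux G i).1), inferInstance⟩

/-- The `i`-th term `F i` of the Fitting series of `G`. -/
def fittingSeries (G : Type u) [Group G] (i : ℕ) : Subgroup G :=
  (fittingSeriesAux G i).1

instance fittingSeries_normal (G : Type u) [Group G] (i : ℕ) : (fittingSeries G i).Normal :=
  (fittingSeriesAux G i).2

/-- A group is torsion-free if its only element of finite order is the identity. -/
def IsTorsionFreeGroup (G : Type u) [Group G] : Prop :=
  ∀ g : G, IsOfFinOrder g → g = 1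

/-- All successive quotients `F (i + 1) / F i` of the Fitting series are torsion-free. -/
def HasTorsionFreeFittingQuotients (G : Type u) [Group G] : Prop :=
  ∀ i : ℕ, IsTorsionFreeGroup
    (fittingSeries G (i + 1) ⧸ (fittingSeries G i).subgroupOf (fittingSeries G (i + 1)))

/-- A group is virtually abelian if it has an abelian subgroup of finite index. -/
def IsVirtuallyAbelian (G : Type u) [Group G] : Prop :=
  ∃ H : Subgroup G, H.FiniteIndex ∧ ∀ a ∈ H, ∀ b ∈ H, a * b = b * a

/-- The pair `(g₁, g₂)` is non-folded in the `G`-set `X`. -/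
def IsNonFoldedPair {G : Type u} [Group G] (X : Type v) [MulAction G X] (g₁ g₂ : G) : Prop :=
  ∀ n : ℕ, 1 ≤ n → ∃ x : X, Set.InjOn (fun p : ℤ × ℤ => (g₂ ^ p.2 * g₁ ^ p.1) • x)
    (Set.Icc (-(n : ℤ)) n ×ˢ Set.Icc (-(n : ℤ)) n)

/-- The pair `(g₁, g₂)` is non-foldable: it is non-folded in every faithful `G`-set. -/
def IsNonFoldablePair {G : Type u} [Group G] (g₁ g₂ : G) : Prop :=
  ∀ (X : Type v) [Nonempty X] [MulAction G X] [FaithfulSMul G X], IsNonFoldedPair X g₁ g₂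

/-- The Schreier graph of a `G`-set `X` with respect to `S`: the vertices are the points of `X`,
and `x` is joined to `s • x` for `s ∈ S` (loops and multiple edges, which do not affect
distances, are discarded). -/
def schreierGraph {G : Type u} [Group G] (S : Set G) (X : Type v) [MulAction G X] :
    SimpleGraph X :=
  SimpleGraph.fromRel fun x y => ∃ s ∈ S, y = s • x

/-- The growth of the action of `G` on `X`: the supremum over `x` of the number of points in the
ball of radius `n` around `x` in the Schreier graph. -/
noncomputable def actionGrowth {G : Type u} [Group G] (S : Set G) (X : Type v) [MulAction G X]
    (n : ℕ) : ℕ∞ :=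
  ⨆ x : X, {y : X | (schreierGraph S X).edist x y ≤ n}.encard

/-- The asymptotic domination `f ≼ g`. -/
def AsympLE (f g : ℕ → ℝ≥0∞) : Prop :=
  ∃ C : ℕ, 0 < C ∧ ∀ n : ℕ, f n ≤ C * g (C * n)

/-- `G` is finitely generated and has a Schreier growth gap `f`: for every finite generating
set `S`, the growth of every faithful `G`-set dominates `f`. -/
def HasSchreierGrowthGap (G : Type u) [Group G] (f : ℕ → ℝ≥0) : Prop :=
  Group.FG G ∧ ∀ S : Set G, S.Finite → Subgroup.closure S = ⊤ →
    ∀ (X : Type v) [Nonempty X] [MulAction G X] [FaithfulSMul G X],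
      AsympLE (fun n => (f n : ℝ≥0∞)) (fun n => (actionGrowth S X n : ℝ≥0∞))

/-! In a faithful `G`-set where a pair is folded on a box, the point stabilizers form a
conjugation-invariant family with trivial intersection, each meeting one finite set. Every `H` in
such a family is close to large subgroups: for an abelian normal `A`, cosets of the subgroups `{b ∈
A | ⁅p, b⁆ ∈ H}` cover `A`, so by B. H. Neumann some `p` has `⁅p, A⁆ ^ k ⊆ H` with `k` independent
of `H` (`exists_mem_almostCentralizer`).

This yields pairs `(a, t)` with `a ∈ A` torsion-free and no power of `t` commuting with `a`
(`isDetectingPair_of_not_commute`), and lifts pairs through quotients by self-centralizing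
torsion-free abelian kernels (`IsDetecting.lift`). Descending the Fitting series from the trivial
quotient, either a pair lifts from `G ⧸ F (i + 1)` or a new one appears in `G ⧸ F i`: from a
non-abelian Fitting subgroup, or, once `G ⧸ F (i + 1)` is abelian, from finite generation. -/

open scoped commutatorElement Pointwise

/-! ### Detection by conjugation-invariant families -/

/-- A set `P` is detecting if no conjugation-invariant family of subgroups with trivial
intersection has all its members meeting `P`. -/
def IsDetecting {G : Type u} [Group G] (P : Set G) : Prop :=
  ∀ F : Set (Subgroup G), (∀ H ∈ F, ∀ g : G, H.comap (MulAut.conj g).toMonoidHom ∈ F) →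
    (∀ H ∈ F, ∃ p ∈ P, p ∈ H) → sInf F ≠ ⊥

/-- The box `[-n, n]²` in `ℤ²`. -/
def intBox (n : ℕ) : Set (ℤ × ℤ) := Set.Icc (-(n : ℤ)) n ×ˢ Set.Icc (-(n : ℤ)) n

/-- The elements which have to avoid a point stabilizer for the map
`p ↦ g₂ ^ p.2 * g₁ ^ p.1 • x` to be injective on `[-n, n]²`. -/
def foldSet {G : Type u} [Group G] (g₁ g₂ : G) (n : ℕ) : Set G :=
  {x | ∃ p ∈ intBox n, ∃ q ∈ intBox n, p ≠ q ∧
    x = (g₂ ^ q.2 * g₁ ^ q.1)⁻¹ * (g₂ ^ p.2 * g₁ ^ p.1)}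

theorem foldSet_finite {G : Type u} [Group G] (g₁ g₂ : G) (n : ℕ) : (foldSet g₁ g₂ n).Finite := by
  have hb : (intBox n).Finite := (Set.finite_Icc _ _).prod (Set.finite_Icc _ _)
  refine ((hb.prod hb).image fun z : (ℤ × ℤ) × (ℤ × ℤ) =>
    (g₂ ^ z.2.2 * g₁ ^ z.2.1)⁻¹ * (g₂ ^ z.1.2 * g₁ ^ z.1.1)).subset ?_
  rintro _ ⟨p, hp, q, hq, -, rfl⟩
  exact ⟨(p, q), ⟨hp, hq⟩, rfl⟩

theorem image_foldSet {G H : Type*} [Group G] [Group H] (f : G →* H) (g₁ g₂ : G) (n : ℕ) :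
    f '' foldSet g₁ g₂ n = foldSet (f g₁) (f g₂) n := by
  ext x
  constructor
  · rintro ⟨_, ⟨p, hp, q, hq, hpq, rfl⟩, rfl⟩
    exact ⟨p, hp, q, hq, hpq, by simp⟩
  · rintro ⟨p, hp, q, hq, hpq, rfl⟩
    exact ⟨_, ⟨p, hp, q, hq, hpq, rfl⟩, by simp⟩

/-- A group-theoretic criterion for non-foldability, free of universe constraints. -/
def IsDetectingPair {G : Type u} [Group G] (g₁ g₂ : G) : Prop :=
  ∀ n : ℕ, IsDetecting (foldSet g₁ g₂ n)

theorem IsDetectingPair.isNonFoldablePair {G : Type u} [Group G] {g₁ g₂ : G}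
    (h : IsDetectingPair g₁ g₂) : IsNonFoldablePair.{u, v} g₁ g₂ := by
  intro X _ _ _ n _
  by_contra! hX
  refine h n (Set.range fun x : X => MulAction.stabilizer G x) ?_ ?_ ?_
  · rintro _ ⟨x, rfl⟩ g
    refine ⟨g⁻¹ • x, ?_⟩
    ext y
    simp [MulAction.mem_stabilizer_iff, mul_smul, eq_inv_smul_iff]
  · rintro _ ⟨x, rfl⟩
    have hx := hX x
    simp only [Set.InjOn, not_forall] at hx
    obtain ⟨p, hp, q, hq, e, hpq⟩ := hx
    refine ⟨_, ⟨p, hp, q, hq, hpq, rfl⟩, ?_⟩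
    rw [MulAction.mem_stabilizer_iff, mul_smul, inv_smul_eq_iff]
    exact e
  · rw [eq_bot_iff]
    intro g hg
    rw [Subgroup.mem_bot]
    refine FaithfulSMul.eq_of_smul_eq_smul (α := X) fun x => ?_
    rw [one_smul]
    exact Subgroup.mem_sInf.1 hg _ ⟨x, rfl⟩

/-- A family in the larger group pulls back to one in the subgroup, still with trivial intersection.
-/
theorem IsDetecting.image {G H : Type*} [Group G] [Group H] {f : H →* G}
    (hf : Function.Injective f) {P : Set H} (hP : IsDetecting P) : IsDetecting (f '' P) := by
  intro F hconj hF hbot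
  refine hP ((fun K : Subgroup G => K.comap f) '' F) ?_ ?_ ?_
  · rintro _ ⟨K, hK, rfl⟩ h
    refine ⟨_, hconj K hK (f h), ?_⟩
    ext x
    simp
  · rintro _ ⟨K, hK, rfl⟩
    obtain ⟨_, ⟨p, hp, rfl⟩, hpK⟩ := hF K hK
    exact ⟨p, hp, hpK⟩
  · rw [eq_bot_iff]
    intro x hx
    have : f x ∈ sInf F := Subgroup.mem_sInf.2 fun K hK =>
      Subgroup.mem_sInf.1 hx _ ⟨K, hK, rfl⟩
    rw [hbot, Subgroup.mem_bot] at this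
    exact (hf (by simpa using this) : x = 1)

theorem IsDetectingPair.map {G H : Type*} [Group G] [Group H] {f : H →* G}
    (hf : Function.Injective f) {g₁ g₂ : H} (h : IsDetectingPair g₁ g₂) :
    IsDetectingPair (f g₁) (f g₂) := fun n => by
  rw [← image_foldSet]
  exact (h n).image hf

/-! ### Almost centralizers and coset covers -/

theorem Subgroup.Normal.commutatorElement_mem {G : Type u} [Group G] {A : Subgroup G}
    (hn : A.Normal) (x : G) {b : G} (hb : b ∈ A) : ⁅x, b⁆ ∈ A :=
  A.mul_mem (hn.conj_mem b hb x) (A.inv_mem hb)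

/-- For an abelian normal subgroup `A`, the elements `g` with `⁅g, A⁆ ^ k ⊆ H`. -/
def almostCentralizer {G : Type u} [Group G] (A : Subgroup G) [A.Normal]
    (hA : ∀ a ∈ A, ∀ b ∈ A, Commute a b) (k : ℕ) (H : Subgroup G) : Subgroup G where
  carrier := {g | ∀ a ∈ A, ⁅g, a⁆ ^ k ∈ H}
  one_mem' := fun a _ => by simp [H.one_mem]
  mul_mem' := by
    intro g h hg hh a ha
    have hn : A.Normal := inferInstance
    have h1 : h * a * h⁻¹ ∈ A := hn.conj_mem a ha h
    have h2 : ⁅g * h, a⁆ = ⁅g, h * a * h⁻¹⁆ * ⁅h, a⁆ := by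
      simp only [commutatorElement_def]; group
    rw [h2, (hA _ (hn.commutatorElement_mem g h1) _ (hn.commutatorElement_mem h ha)).mul_pow]
    exact H.mul_mem (hg _ h1) (hh _ ha)
  inv_mem' := by
    intro g hg a ha
    have hn : A.Normal := inferInstance
    have h1 : g⁻¹ * a * g ∈ A := by simpa using hn.conj_mem a ha g⁻¹
    have h2 : ⁅g⁻¹, a⁆ = ⁅g, g⁻¹ * a * g⁆⁻¹ := by
      simp only [commutatorElement_def]; group
    rw [h2, inv_pow]
    exact H.inv_mem (hg _ h1)

section
variable {G : Type u} [Group G] {A : Subgroup G} [A.Normal]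

theorem mem_almostCentralizer {hA : ∀ a ∈ A, ∀ b ∈ A, Commute a b} {k : ℕ} {H : Subgroup G}
    {g : G} : g ∈ almostCentralizer A hA k H ↔ ∀ a ∈ A, ⁅g, a⁆ ^ k ∈ H := Iff.rfl

theorem le_almostCentralizer (hA : ∀ a ∈ A, ∀ b ∈ A, Commute a b) (k : ℕ) (H : Subgroup G) :
    A ≤ almostCentralizer A hA k H := fun g hg a ha => by
  simp [(hA g hg a ha).commutator_eq, H.one_mem]

theorem almostCentralizer_comap_conj (hA : ∀ a ∈ A, ∀ b ∈ A, Commute a b) (k : ℕ)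
    (H : Subgroup G) (g : G) :
    almostCentralizer A hA k (H.comap (MulAut.conj g).toMonoidHom) =
      (almostCentralizer A hA k H).comap (MulAut.conj g).toMonoidHom := by
  have hn : A.Normal := inferInstance
  ext x
  simp only [mem_almostCentralizer, Subgroup.mem_comap, MulEquiv.coe_toMonoidHom,
    MulAut.conj_apply, map_pow]
  constructor
  · intro h a ha
    convert h (g⁻¹ * a * g) (by simpa using hn.conj_mem a ha g⁻¹) using 2
    simp only [commutatorElement_def]; group
  · intro h a ha
    convert h (g * a * g⁻¹) (hn.conj_mem a ha g) using 2
    simp only [commutatorElement_def]; group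

/-- If every `A`-conjugate of `H` meets the finite set `P`, then some `p ∈ P` satisfies
`⁅p, A⁆ ^ |P|! ⊆ H`. -/
theorem exists_mem_almostCentralizer (hA : ∀ a ∈ A, ∀ b ∈ A, Commute a b) (H : Subgroup G)
    (P : Finset G) (hP : ∀ b ∈ A, ∃ p ∈ P, b⁻¹ * p * b ∈ H) :
    ∃ p ∈ P, p ∈ almostCentralizer A hA P.card.factorial H := by
  classical
  have hn : A.Normal := inferInstance
  let φ (p : G) : A →* A :=
    { toFun := fun b => ⟨⁅p, (b : G)⁆, hn.commutatorElement_mem p b.2⟩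
      map_one' := by ext; simp
      map_mul' := by
        intro b c
        ext
        have := hA _ b.2 _ (hn.commutatorElement_mem p c.2)
        have e : ⁅p, (b * c : G)⁆ = ⁅p, (b : G)⁆ * (b * ⁅p, (c : G)⁆ * (b : G)⁻¹) := by
          simp only [commutatorElement_def]; group
        change ⁅p, (b * c : G)⁆ = ⁅p, (b : G)⁆ * ⁅p, (c : G)⁆
        rw [e, this.eq, mul_inv_cancel_right] }
  let C (p : G) : Subgroup A := (H.comap A.subtype).comap (φ p)
  -- The `b` conjugating `p` into `H` lie in one coset of `C p`, because `A` is abelian.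
  have hcov : ∀ p ∈ P, ∃ g : A, ∀ b : A, (b : G)⁻¹ * p * b ∈ H → g⁻¹ * b ∈ C p := by
    intro p _
    by_cases h : ∃ g : A, (g : G)⁻¹ * p * g ∈ H
    · obtain ⟨g, hg⟩ := h
      refine ⟨g, fun b hb => ?_⟩
      have key : ((φ p (g⁻¹ * b) : A) : G) = ((b : G)⁻¹ * p * b) * ((g : G)⁻¹ * p * g)⁻¹ := by
        have h1 := hA _ (hn.conj_mem _ (A.mul_mem b.2 (A.inv_mem g.2)) p) _ (A.inv_mem b.2)
        have h2 := hA _ b.2 _ (A.inv_mem g.2)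
        calc ((φ p (g⁻¹ * b) : A) : G) = p * ((g : G)⁻¹ * b) * p⁻¹ * ((g : G)⁻¹ * b)⁻¹ := rfl
          _ = p * ((b : G) * (g : G)⁻¹) * p⁻¹ * (b : G)⁻¹ * g := by rw [mul_inv_rev, ← h2.eq]; group
          _ = _ := by rw [h1.eq]; group
      change ((φ p (g⁻¹ * b) : A) : G) ∈ H
      rw [key]
      exact H.mul_mem hb (H.inv_mem hg)
    · push Not at h
      exact ⟨1, fun b hb => absurd hb (h b)⟩
  choose! g hg using hcov
  have hc : ⋃ p ∈ P, g p • (C p : Set A) = Set.univ := by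
    refine Set.iUnion₂_eq_univ_iff.2 fun b => ?_
    obtain ⟨p, hp, hb⟩ := hP b b.2
    exact ⟨p, hp, by rw [mem_leftCoset_iff]; exact hg p hp b hb⟩
  -- Neumann's lemma: one of the covering subgroups has index at most `|P|`, hence dividing `|P|!`.
  obtain ⟨p, hp, hfi, hidx⟩ := Subgroup.exists_index_le_card_of_leftCoset_cover hc
  refine ⟨p, hp, fun a ha => ?_⟩
  obtain ⟨m, hm⟩ : (C p).index ∣ P.card.factorial :=
    Nat.dvd_factorial (Nat.pos_of_ne_zero hfi.index_ne_zero) hidx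
  have : (C p).Normal := ⟨fun x hx y => by
    have : y * x * y⁻¹ = x := by
      ext; simp [(hA _ y.2 _ x.2).eq]
    rwa [this]⟩
  have h1 : (⟨a, ha⟩ : A) ^ P.card.factorial ∈ C p := by
    rw [hm, pow_mul]
    exact (C p).pow_mem ((C p).pow_index_mem _) m
  have h2 : ((φ p (⟨a, ha⟩ ^ P.card.factorial) : A) : G) ∈ H := h1
  rw [map_pow] at h2
  exact h2

end

/-! ### Lifting and constructing detecting pairs -/

/-- Detection lifts through a surjection whose kernel is abelian, torsion-free and
self-centralizing. -/
theorem IsDetecting.lift {G Q : Type*} [Group G] [Group Q] {π : G →* Q}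
    (hπ : Function.Surjective π) (hA : ∀ a ∈ π.ker, ∀ b ∈ π.ker, Commute a b)
    (htf : ∀ a ∈ π.ker, IsOfFinOrder a → a = 1)
    (hcent : ∀ g, (∀ a ∈ π.ker, Commute g a) → g ∈ π.ker) {P : Set G} (hfin : P.Finite)
    (hP : IsDetecting (π '' P)) : IsDetecting P := by
  intro F hconj hF hbot
  have hn : π.ker.Normal := inferInstance
  set k := hfin.toFinset.card.factorial
  refine hP ((fun H => (almostCentralizer π.ker hA k H).map π) '' F) ?_ ?_ ?_
  · rintro _ ⟨H, hH, rfl⟩ q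
    obtain ⟨g, rfl⟩ := hπ q
    refine ⟨_, hconj H hH g, ?_⟩
    dsimp only
    rw [almostCentralizer_comap_conj]
    ext x
    obtain ⟨x, rfl⟩ := hπ x
    constructor
    · rintro ⟨y, hy, e⟩
      exact ⟨g * y * g⁻¹, hy, by simp [← e]⟩
    · rintro ⟨y, hy, e⟩
      refine ⟨g⁻¹ * y * g, ?_, ?_⟩
      · simpa [mul_assoc] using hy
      · simp [e, mul_assoc]
  · rintro _ ⟨H, hH, rfl⟩
    obtain ⟨p, hp, hpH⟩ := exists_mem_almostCentralizer hA H hfin.toFinset fun b hb => by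
      obtain ⟨p, hp, h⟩ := hF _ (hconj H hH b⁻¹)
      exact ⟨p, by simpa using hp, by simpa using h⟩
    exact ⟨π p, ⟨p, by simpa using hp, rfl⟩, ⟨p, hpH, rfl⟩⟩
  · rw [eq_bot_iff]
    intro q hq
    obtain ⟨g, rfl⟩ := hπ q
    rw [Subgroup.mem_bot]
    -- An element lying in all almost centralizers has `⁅g, a⁆ ^ k` in every `H`, so trivial;
    -- torsion-freeness removes the exponent `k`.
    refine hcent g fun a ha => commutatorElement_eq_one_iff_commute.1 ?_
    refine htf _ (hn.commutatorElement_mem g ha) ?_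
    rw [isOfFinOrder_iff_pow_eq_one]
    refine ⟨k, Nat.factorial_pos _, ?_⟩
    rw [← Subgroup.mem_bot, ← hbot]
    refine Subgroup.mem_sInf.2 fun H hH => ?_
    obtain ⟨g', hg', e⟩ := Subgroup.mem_sInf.1 hq _ ⟨H, hH, rfl⟩
    have : g = g' * (g'⁻¹ * g) := by group
    have hg : g ∈ almostCentralizer π.ker hA k H := by
      rw [this]
      refine mul_mem hg' (le_almostCentralizer hA k H ?_)
      simp [MonoidHom.mem_ker, e]
    exact hg a ha

theorem IsDetectingPair.lift {G Q : Type*} [Group G] [Group Q] {π : G →* Q}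
    (hπ : Function.Surjective π) (hA : ∀ a ∈ π.ker, ∀ b ∈ π.ker, Commute a b)
    (htf : ∀ a ∈ π.ker, IsOfFinOrder a → a = 1)
    (hcent : ∀ g, (∀ a ∈ π.ker, Commute g a) → g ∈ π.ker) {g₁ g₂ : G}
    (hP : IsDetectingPair (π g₁) (π g₂)) : IsDetectingPair g₁ g₂ := fun n =>
  IsDetecting.lift hπ hA htf hcent (foldSet_finite _ _ _) (by rw [image_foldSet]; exact hP n)

/-- An element `a` of a torsion-free abelian normal subgroup forms a detecting pair with any `t`
none of whose powers commutes with `a`. -/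
theorem isDetectingPair_of_not_commute {G : Type u} [Group G] {A : Subgroup G} [A.Normal]
    (hA : ∀ a ∈ A, ∀ b ∈ A, Commute a b) (htf : ∀ a ∈ A, IsOfFinOrder a → a = 1)
    {a t : G} (ha : a ∈ A) (ht : ∀ J : ℕ, 0 < J → ¬ Commute (t ^ J) a) : IsDetectingPair a t := by
  classical
  intro n F hconj hF hbot
  have hn : A.Normal := inferInstance
  -- Differences of exponents in the box are at most `2 * n` in absolute value, so nonzero ones
  -- divide `J`.
  set J := (2 * n).factorial with hJ
  -- Only the elements involving a nonzero power of `t`. The others are powers of `a`, unchanged by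
  -- conjugation by `A`.
  set P := (foldSet_finite a t n).toFinset.filter fun x =>
    ∃ k : ℤ, k ≠ 0 ∧ |k| ≤ 2 * n ∧ ∃ c ∈ A, ∃ d ∈ A, x = c * t ^ k * d with hPdef
  set m := P.card.factorial with hm
  have hdvd : ∀ k : ℤ, k ≠ 0 → |k| ≤ 2 * n → k ∣ (J : ℤ) := by
    intro k hk hkn
    rw [← Int.natAbs_dvd_natAbs, Int.natAbs_natCast]
    exact Nat.dvd_factorial (Int.natAbs_pos.2 hk) (by zify; exact hkn)
  have hfold : ∀ x ∈ foldSet a t n, ∃ k : ℤ, k ≠ 0 ∧ |k| ≤ 2 * n ∧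
      (x = a ^ k ∨ ∃ c ∈ A, ∃ d ∈ A, x = c * t ^ k * d) := by
    rintro _ ⟨p, ⟨⟨p1, p2⟩, p3, p4⟩, q, ⟨⟨q1, q2⟩, q3, q4⟩, hpq, rfl⟩
    by_cases h : p.2 = q.2
    · refine ⟨p.1 - q.1, fun h' => hpq (Prod.ext (by omega) h), by rw [abs_le]; omega, Or.inl ?_⟩
      rw [h, zpow_sub]
      have := (Commute.refl a).zpow_zpow p.1 (-q.1)
      rw [zpow_neg] at this
      rw [this.eq]; group
    · refine ⟨p.2 - q.2, by omega, by rw [abs_le]; omega, Or.inr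
        ⟨a ^ (-q.1), A.zpow_mem ha _, a ^ p.1, A.zpow_mem ha _, ?_⟩⟩
      rw [show p.2 - q.2 = - q.2 + p.2 by ring, zpow_add]; group
  have hpow : ∀ H ∈ F, ∀ k : ℤ, k ≠ 0 → |k| ≤ 2 * n → a ^ k ∈ H → a ^ (J * m) ∈ H := by
    intro H _ k hk hkn h
    obtain ⟨l, hl⟩ := hdvd k hk hkn
    have := H.pow_mem (H.zpow_mem h l) m
    rwa [← zpow_mul, ← hl, zpow_natCast, ← pow_mul] at this
  have hdich : ∀ H ∈ F, a ^ (J * m) ∈ H ∨ t ^ J ∈ almostCentralizer A hA m H := by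
    intro H hH
    by_cases hex : ∃ k : ℤ, k ≠ 0 ∧ |k| ≤ 2 * n ∧ a ^ k ∈ H
    · obtain ⟨k, hk, hkn, h⟩ := hex
      exact Or.inl (hpow H hH k hk hkn h)
    right
    push Not at hex
    obtain ⟨p, hp, hpH⟩ := exists_mem_almostCentralizer hA H P fun b hb => by
      obtain ⟨p, hp, h⟩ := hF _ (hconj H hH b⁻¹)
      have h : b⁻¹ * p * b ∈ H := by simpa using h
      obtain ⟨k, hk, hkn, rfl | hk'⟩ := hfold p hp
      · refine absurd ?_ (hex k hk hkn)
        rwa [mul_assoc, ((hA a ha b hb).zpow_left k).eq, inv_mul_cancel_left] at h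
      · exact ⟨p, by rw [hPdef, Finset.mem_filter]; exact ⟨by simpa using hp, k, hk, hkn, hk'⟩, h⟩
    obtain ⟨-, k, hk, hkn, c, hc, d, hd, rfl⟩ := Finset.mem_filter.1 hp
    have hle := le_almostCentralizer hA m H
    have htk : t ^ k ∈ almostCentralizer A hA m H := by
      rwa [Subgroup.mul_mem_cancel_right _ (hle hd), Subgroup.mul_mem_cancel_left _ (hle hc)] at hpH
    obtain ⟨l, hl⟩ := hdvd k hk hkn
    rw [← zpow_natCast, hl, zpow_mul]
    exact Subgroup.zpow_mem _ htk l
  have hfin : ∀ H : Subgroup G, t ^ J ∈ almostCentralizer A hA m H → ⁅t ^ J, a⁆ ^ (J * m) ∈ H := by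
    intro H h
    rw [mul_comm, pow_mul]
    exact H.pow_mem (h a ha) J
  -- Apply the dichotomy to `H` and to its conjugate by `t ^ J`. If both contain `a ^ (J * m)`, then
  -- `H` contains that power of `a` and of `t ^ J * a * (t ^ J)⁻¹`, hence of their quotient.
  -- Otherwise `t ^ J`, fixed by its own conjugation, almost centralizes `A` modulo `H`.
  have hmain : ∀ H ∈ F, ⁅t ^ J, a⁆ ^ (J * m) ∈ H := by
    intro H hH
    have hH' := hconj H hH (t ^ J)
    rcases hdich H hH with h1 | h1
    · rcases hdich _ hH' with h2 | h2
      · have e : ⁅t ^ J, a⁆ = (t ^ J * a * (t ^ J)⁻¹) * a⁻¹ := rfl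
        rw [e, (hA _ (hn.conj_mem a ha _) _ (A.inv_mem ha)).mul_pow, inv_pow]
        refine H.mul_mem ?_ (H.inv_mem h1)
        have h3 : t ^ J * a ^ (J * m) * (t ^ J)⁻¹ ∈ H := h2
        rwa [conj_pow]
      · rw [almostCentralizer_comap_conj] at h2
        have h3 : t ^ J * t ^ J * (t ^ J)⁻¹ ∈ almostCentralizer A hA m H := h2
        rw [mul_inv_cancel_right] at h3
        exact hfin H h3
    · exact hfin H h1
  refine ht J (Nat.factorial_pos _) (commutatorElement_eq_one_iff_commute.1 ?_)
  refine htf _ (hn.commutatorElement_mem _ ha) ?_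
  rw [isOfFinOrder_iff_pow_eq_one]
  refine ⟨J * m, Nat.mul_pos (Nat.factorial_pos _) (Nat.factorial_pos _), ?_⟩
  rw [← Subgroup.mem_bot, ← hbot]
  exact Subgroup.mem_sInf.2 hmain

/-! ### Detecting pairs from the Fitting subgroup -/

theorem le_fittingSubgroup {G : Type u} [Group G] {N : Subgroup G} (hN : N.Normal)
    (hnil : Group.IsNilpotent N) : N ≤ fittingSubgroup G :=
  le_sSup ⟨hN, hnil⟩

theorem Subgroup.isNilpotent_of_commutator_le_centralizer {G : Type u} [Group G] {N : Subgroup G}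
    (h : ⁅N, N⁆ ≤ Subgroup.centralizer N) : Group.IsNilpotent N :=
  Subgroup.isNilpotent_of_lowerCentralSeries_eq_bot (n := 2)
    (Subgroup.commutator_eq_bot_iff_le_centralizer.2 h)

/-- With `C` the centralizer of the Fitting subgroup, descend in `m`: if `C ⊓ derivedSeries G (m +
1)` is inside it, then `C ⊓ derivedSeries G m` has central commutators, so is normal nilpotent. -/
theorem mem_fittingSubgroup_of_commute {G : Type u} [Group G] (hG : Group.IsSolvable G) {g : G}
    (hg : ∀ a ∈ fittingSubgroup G, Commute g a) : g ∈ fittingSubgroup G := by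
  set C := Subgroup.centralizer (fittingSubgroup G : Set G)
  obtain ⟨n, hn⟩ := hG.solvable
  have key : ∀ i, ∀ m, m + i = n → C ⊓ derivedSeries G m ≤ fittingSubgroup G := by
    intro i
    induction i with
    | zero => intro m hm; rw [show m = n by omega, hn]; simp
    | succ i ih =>
      intro m hm
      refine le_fittingSubgroup inferInstance
        (Subgroup.isNilpotent_of_commutator_le_centralizer ?_)
      have h1 : ⁅C ⊓ derivedSeries G m, C ⊓ derivedSeries G m⁆ ≤ fittingSubgroup G := by
        refine le_trans (le_inf ?_ ?_) (ih (m + 1) (by omega))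
        · exact (Subgroup.commutator_mono inf_le_left inf_le_left).trans C.commutator_le_self
        · exact Subgroup.commutator_mono inf_le_right inf_le_right
      refine h1.trans fun x hx => Subgroup.mem_centralizer_iff.2 fun y hy => ?_
      exact (Subgroup.mem_centralizer_iff.1 hy.1 x hx).symm
  refine key n 0 (by simp) ⟨Subgroup.mem_centralizer_iff.2 fun a ha => (hg a ha).eq.symm, ?_⟩
  simp

/-- Here `⁅a, t ^ J⁆ = ⁅a, t⁆ ^ J`, which torsion-freeness keeps nontrivial. -/
theorem isDetectingPair_of_commute_commutatorElement {G : Type u} [Group G] {A : Subgroup G}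
    [A.Normal] (hA : ∀ a ∈ A, ∀ b ∈ A, Commute a b) (htf : ∀ a ∈ A, IsOfFinOrder a → a = 1)
    {a t : G} (ha : a ∈ A) (ht : Commute ⁅a, t⁆ t) (hne : ⁅a, t⁆ ≠ 1) : IsDetectingPair a t := by
  have hn : A.Normal := inferInstance
  refine isDetectingPair_of_not_commute hA htf ha fun J hJ h => hne (htf _ ?_ ?_)
  · rw [← commutatorElement_inv]
    exact A.inv_mem (hn.commutatorElement_mem t ha)
  · rw [isOfFinOrder_iff_pow_eq_one]
    refine ⟨J, hJ, ?_⟩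
    have e : a * t * a⁻¹ = ⁅a, t⁆ * t := by simp [commutatorElement_def]
    have h1 : a * t ^ J * a⁻¹ = ⁅a, t⁆ ^ J * t ^ J := by rw [← conj_pow, e, ht.mul_pow]
    rwa [← h.eq, mul_inv_cancel_right, right_eq_mul] at h1

/-- Any `a` in the second center but not in the center generates with the center an abelian normal
subgroup, and its commutators are central. -/
theorem exists_isDetectingPair_of_isNilpotent {N : Type u} [Group N] [Group.IsNilpotent N]
    (htf : ∀ a : N, IsOfFinOrder a → a = 1) (hne : ¬ ∀ a b : N, Commute a b) :
    ∃ a t : N, IsDetectingPair a t := by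
  obtain ⟨a, ha, ha'⟩ : ∃ a ∈ Subgroup.upperCentralSeries N 2, a ∉ Subgroup.center N := by
    by_contra! h
    have key : ∀ n, Subgroup.upperCentralSeries N (n + 1) ≤ Subgroup.center N := by
      intro n
      induction n with
      | zero => rw [Subgroup.upperCentralSeries_one]
      | succ n ih =>
        intro x hx
        refine h x fun y => ?_
        change ⁅x, y⁆ ∈ Subgroup.upperCentralSeries N 1
        rw [Subgroup.upperCentralSeries_one]
        exact ih (hx y)
    obtain ⟨n, hn⟩ := Group.IsNilpotent.nilpotent N
    refine hne fun a b => ?_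
    have ha : a ∈ Subgroup.upperCentralSeries N (n + 1) :=
      Subgroup.upperCentralSeries_mono N (Nat.le_succ n) (by rw [hn]; trivial)
    exact (Subgroup.mem_center_iff.1 (key n ha) b).symm
  have hc : ∀ y : N, ⁅a, y⁆ ∈ Subgroup.center N := fun y => by
    have : ⁅a, y⁆ ∈ Subgroup.upperCentralSeries N 1 := ha y
    rwa [Subgroup.upperCentralSeries_one] at this
  have hA : ∀ x ∈ Subgroup.center N ⊔ Subgroup.zpowers a, ∃ z ∈ Subgroup.center N, ∃ k : ℤ,
      x = z * a ^ k := by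
    intro x hx
    obtain ⟨z, hz, _, ⟨k, rfl⟩, rfl⟩ := Subgroup.mem_sup_of_normal_left.1 hx
    exact ⟨z, hz, k, rfl⟩
  have haA : a ∈ Subgroup.center N ⊔ Subgroup.zpowers a :=
    Subgroup.mem_sup_right (Subgroup.mem_zpowers a)
  have hz : ∀ z ∈ Subgroup.center N, ∀ x, Commute z x := fun z hz x =>
    (Subgroup.mem_center_iff.1 hz x).symm
  have : (Subgroup.center N ⊔ Subgroup.zpowers a).Normal := ⟨fun x hx g => by
    obtain ⟨z, hz', k, rfl⟩ := hA x hx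
    have e2 : g * (z * a ^ k) * g⁻¹ = z * (g * a * g⁻¹) ^ k := by
      rw [conj_zpow, ← mul_assoc, ← (hz z hz' g).eq]; group
    have e3 : g * a * g⁻¹ = ⁅a, g⁆⁻¹ * a := by simp only [commutatorElement_def]; group
    rw [e2, e3]
    refine mul_mem (Subgroup.mem_sup_left hz') (zpow_mem (mul_mem ?_ haA) k)
    exact Subgroup.mem_sup_left (inv_mem (hc g))⟩
  have hAc : ∀ x ∈ Subgroup.center N ⊔ Subgroup.zpowers a,
      ∀ y ∈ Subgroup.center N ⊔ Subgroup.zpowers a, Commute x y := by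
    intro x hx y hy
    obtain ⟨z, hz1, k, rfl⟩ := hA x hx
    obtain ⟨w, hw1, l, rfl⟩ := hA y hy
    exact ((hz z hz1 _).mul_left (((hz w hw1 _).symm).mul_right
      ((Commute.refl a).zpow_zpow k l)))
  obtain ⟨t, ht⟩ : ∃ t, t * a ≠ a * t := by
    by_contra! h
    exact ha' (Subgroup.mem_center_iff.2 h)
  refine ⟨a, t, isDetectingPair_of_commute_commutatorElement hAc (fun x _ => htf x) haA
    (hz _ (hc t) t) fun h => ht ?_⟩
  exact (commutatorElement_eq_one_iff_mul_comm.1 h).symm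

/-- A torsion-free Fitting subgroup is abelian, or else there is a detecting pair. -/
theorem exists_isDetectingPair_or_commute_fittingSubgroup {G : Type u} [Group G]
    (htf : ∀ a ∈ fittingSubgroup G, IsOfFinOrder a → a = 1) :
    (∃ g₁ g₂ : G, IsDetectingPair g₁ g₂) ∨
      ∀ a ∈ fittingSubgroup G, ∀ b ∈ fittingSubgroup G, Commute a b := by
  by_contra! h
  obtain ⟨hno, x, hx, y, hy, hxy⟩ := h
  have hab : ∀ N : Subgroup G, N.Normal → Group.IsNilpotent N → ∀ a ∈ N, ∀ b ∈ N, Commute a b := by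
    intro N hN hnil
    by_contra! h
    obtain ⟨a, ha, b, hb, hab⟩ := h
    obtain ⟨a', t, h⟩ := exists_isDetectingPair_of_isNilpotent (N := N)
      (fun c hc => Subtype.ext (htf c (le_fittingSubgroup hN hnil c.2)
        (N.subtype.isOfFinOrder hc)))
      (fun h => hab (congrArg N.subtype (h ⟨a, ha⟩ ⟨b, hb⟩)))
    exact hno _ _ (h.map N.subtype_injective)
  have hab2 : ∀ N : Subgroup G, N.Normal → Group.IsNilpotent N → ∀ M : Subgroup G, M.Normal →
      Group.IsNilpotent M → ∀ a ∈ N, ∀ b ∈ M, Commute a b := by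
    intro N hN hnil M hM hnilM a ha b hb
    by_contra hcomm
    -- The commutator lies in `N ⊓ M`, so it commutes with `b` since `M` is abelian.
    have hM1 : ⁅a, b⁆ ∈ M := hM.commutatorElement_mem a hb
    have hN1 : ⁅a, b⁆ ∈ N := by
      rw [← commutatorElement_inv]
      exact inv_mem (hN.commutatorElement_mem b ha)
    exact hno _ _ (isDetectingPair_of_commute_commutatorElement (hab N hN hnil)
      (fun c hc => htf c (le_fittingSubgroup hN hnil hc)) ha (hab M hM hnilM _ hM1 _ hb)
      fun h => hcomm (commutatorElement_eq_one_iff_commute.1 h))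
  have h1 : ∀ N : Subgroup G, N.Normal → Group.IsNilpotent N →
      fittingSubgroup G ≤ Subgroup.centralizer N := fun N hN hnil =>
    sSup_le fun M hM a ha => Subgroup.mem_centralizer_iff.2 fun b hb =>
      hab2 N hN hnil M hM.1 hM.2 b hb a ha
  have h2 : fittingSubgroup G ≤ Subgroup.centralizer (fittingSubgroup G : Set G) :=
    sSup_le fun M hM a ha => Subgroup.mem_centralizer_iff.2 fun b hb =>
      (Subgroup.mem_centralizer_iff.1 (h1 M hM.1 hM.2 hb) a ha).symm
  exact hxy (Subgroup.mem_centralizer_iff.1 (h2 hy) x hx)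

/-- Without a detecting pair, each element has a power commuting with any given element of the
Fitting subgroup. Finite generation makes one power of each generator centralize the whole
commutator subgroup, which forces that generator into the Fitting subgroup. -/
theorem exists_isDetectingPair_of_commutator_le {G : Type u} [Group G] (hfg : Group.FG G)
    (hA : ∀ a ∈ fittingSubgroup G, ∀ b ∈ fittingSubgroup G, Commute a b)
    (htf : ∀ a ∈ fittingSubgroup G, IsOfFinOrder a → a = 1)
    (hcomm : commutator G ≤ fittingSubgroup G)
    (hiso : ∀ (g : G) (J : ℕ), 0 < J → g ^ J ∈ fittingSubgroup G → g ∈ fittingSubgroup G)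
    (hne : ¬ ∀ a b : G, Commute a b) : ∃ g₁ g₂ : G, IsDetectingPair g₁ g₂ := by
  by_contra! hno
  have hper : ∀ t, ∀ a ∈ fittingSubgroup G, ∃ J : ℕ, 0 < J ∧ Commute (t ^ J) a := by
    intro t a ha
    by_contra! h
    exact hno a t (isDetectingPair_of_not_commute hA htf ha h)
  have hmem (x y : G) : ⁅x, y⁆ ∈ commutator G :=
    Subgroup.commutator_mem_commutator (Subgroup.mem_top x) (Subgroup.mem_top y)
  obtain ⟨S, hS⟩ := Group.fg_def.1 hfg
  choose! f hf0 hf using hper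
  suffices h : Subgroup.closure (S : Set G) ≤ fittingSubgroup G by
    rw [hS] at h
    exact hne fun a b => hA a (h trivial) b (h trivial)
  rw [Subgroup.closure_le]
  intro s hs
  set J := ∏ x ∈ S, ∏ y ∈ S, f s ⁅x, y⁆ with hJ
  have hJ0 : 0 < J := Finset.prod_pos fun x _ => Finset.prod_pos fun y _ =>
    hf0 _ _ (hcomm (hmem x y))
  have hJc : ∀ x ∈ S, ∀ y ∈ S, Commute (s ^ J) ⁅x, y⁆ := by
    intro x hx y hy
    obtain ⟨k, hk⟩ : f s ⁅x, y⁆ ∣ J :=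
      (Finset.dvd_prod_of_mem (fun y => f s ⁅x, y⁆) hy).trans
        (Finset.dvd_prod_of_mem (fun x => ∏ y ∈ S, f s ⁅x, y⁆) hx)
    rw [hk, pow_mul]
    exact (hf s _ (hcomm (hmem x y))).pow_left k
  let D : Subgroup G := fittingSubgroup G ⊓ Subgroup.centralizer {s ^ J}
  have hDmem : ∀ x, x ∈ D ↔ x ∈ fittingSubgroup G ∧ Commute (s ^ J) x := fun x => by
    rw [Subgroup.mem_inf, Subgroup.mem_centralizer_singleton_iff]
    exact and_congr_right fun _ => ⟨fun h => h.symm, fun h => h.symm⟩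
  -- Conjugates of `s ^ J` differ from it by commutators, which commute with the abelian Fitting
  -- subgroup.
  have hD : D.Normal := ⟨fun x hx g => by
    rw [hDmem] at hx ⊢
    refine ⟨(fittingSubgroup_normal G).conj_mem x hx.1 g, ?_⟩
    have h1 : Commute (s ^ J * ⁅(s ^ J)⁻¹, g⁻¹⁆) x := hx.2.mul_left (hA _ (hcomm (hmem _ _)) _ hx.1)
    have h2 := h1.map (MulAut.conj g).toMonoidHom
    convert h2 using 1
    · simp only [MulEquiv.coe_toMonoidHom, MulAut.conj_apply, commutatorElement_def]
      group
    · rfl⟩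
  -- Modulo `D` the generators commute pairwise, so `G ⧸ D` is abelian.
  have hDcomm : commutator G ≤ D := by
    let E (x : G) : Subgroup G := (Subgroup.centralizer {(x : G ⧸ D)}).comap (QuotientGroup.mk' D)
    have hE : ∀ x y, y ∈ E x ↔ ⁅x, y⁆ ∈ D := fun x y => by
      rw [← QuotientGroup.eq_one_iff (N := D), Subgroup.mem_comap, Subgroup.mem_centralizer_singleton_iff,
        QuotientGroup.mk'_apply, eq_comm, ← commutatorElement_eq_one_iff_mul_comm]
      rfl
    have hE' : ∀ x y, y ∈ E x → x ∈ E y := fun x y h => by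
      rw [hE, ← commutatorElement_inv, inv_mem_iff] at h
      exact (hE y x).2 h
    have h1 : ∀ x ∈ S, ∀ y, y ∈ E x := by
      intro x hx y
      have : Subgroup.closure (S : Set G) ≤ E x := (Subgroup.closure_le _).2 fun y hy =>
        (hE x y).2 ((hDmem _).2 ⟨hcomm (hmem x y), hJc x hx y hy⟩)
      exact this (by rw [hS]; trivial)
    rw [commutator_def, Subgroup.commutator_le]
    intro y _ x _
    have : Subgroup.closure (S : Set G) ≤ E y := (Subgroup.closure_le _).2 fun x hx =>
      hE' x y (h1 x hx y)
    exact (hE y x).1 (this (by rw [hS]; trivial))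
  -- This subgroup contains the commutator subgroup, so it is normal; it also centralizes it, so it
  -- is nilpotent.
  have hN : commutator G ⊔ Subgroup.zpowers (s ^ J) ≤ fittingSubgroup G := by
    refine le_fittingSubgroup ?_ (Subgroup.isNilpotent_of_commutator_le_centralizer ?_)
    · rw [← Subgroup.commutator_top_left_le_iff]
      exact (Subgroup.commutator_mono le_top le_top).trans le_sup_left
    · refine (Subgroup.commutator_mono le_top le_top : _ ≤ commutator G).trans ?_
      rw [Subgroup.le_centralizer_iff]
      refine sup_le (fun x hx => Subgroup.mem_centralizer_iff.2 fun y hy =>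
        hA _ (hcomm hy) _ (hcomm hx)) ((Subgroup.zpowers_le).2 ?_)
      exact Subgroup.mem_centralizer_iff.2 fun y hy => ((hDmem y).1 (hDcomm hy)).2.eq.symm
  exact hiso s J hJ0 (hN (Subgroup.mem_sup_right (Subgroup.mem_zpowers _)))

/-! ### Descent along the Fitting series -/

section FittingSeries
variable {G : Type u} [Group G]

theorem fittingSeries_succ (i : ℕ) : fittingSeries G (i + 1) =
    (fittingSubgroup (G ⧸ fittingSeries G i)).comap (QuotientGroup.mk' (fittingSeries G i)) := rfl

theorem mk_mem_fittingSubgroup_iff {i : ℕ} {g : G} :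
    (g : G ⧸ fittingSeries G i) ∈ fittingSubgroup (G ⧸ fittingSeries G i) ↔
      g ∈ fittingSeries G (i + 1) := Iff.rfl

theorem fittingSeries_le_succ (i : ℕ) : fittingSeries G i ≤ fittingSeries G (i + 1) := fun g hg => by
  rw [← mk_mem_fittingSubgroup_iff, (QuotientGroup.eq_one_iff g).2 hg]
  exact one_mem _

theorem HasTorsionFreeFittingQuotients.mem_of_pow_mem (h : HasTorsionFreeFittingQuotients G)
    {i : ℕ} {g : G} (hg : g ∈ fittingSeries G (i + 1)) {k : ℕ} (hk : 0 < k)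
    (hgk : g ^ k ∈ fittingSeries G i) : g ∈ fittingSeries G i := by
  have := h i ((⟨g, hg⟩ : fittingSeries G (i + 1)) : _ ⧸ _) (isOfFinOrder_iff_pow_eq_one.2
    ⟨k, hk, by
      rw [← QuotientGroup.mk_pow, QuotientGroup.eq_one_iff, Subgroup.mem_subgroupOf]
      exact hgk⟩)
  rwa [QuotientGroup.eq_one_iff, Subgroup.mem_subgroupOf] at this

theorem HasTorsionFreeFittingQuotients.eq_one_of_isOfFinOrder
    (h : HasTorsionFreeFittingQuotients G) (i : ℕ) (q : G ⧸ fittingSeries G i)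
    (hq : q ∈ fittingSubgroup (G ⧸ fittingSeries G i)) (hfin : IsOfFinOrder q) : q = 1 := by
  obtain ⟨g, rfl⟩ := QuotientGroup.mk_surjective q
  obtain ⟨k, hk, e⟩ := isOfFinOrder_iff_pow_eq_one.1 hfin
  rw [← QuotientGroup.mk_pow, QuotientGroup.eq_one_iff] at e
  exact (QuotientGroup.eq_one_iff g).2 (h.mem_of_pow_mem hq hk e)

theorem derivedSeries_le_fittingSeries_succ {i m : ℕ}
    (h : derivedSeries G (m + 1) ≤ fittingSeries G i) :
    derivedSeries G m ≤ fittingSeries G (i + 1) := by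
  rw [fittingSeries_succ, ← Subgroup.map_le_iff_le_comap]
  have hs : Function.Surjective (QuotientGroup.mk' (fittingSeries G i)) :=
    QuotientGroup.mk'_surjective _
  refine le_fittingSubgroup (Subgroup.Normal.map inferInstance _ hs)
    (Subgroup.isNilpotent_of_commutator_le_centralizer ?_)
  rw [← Subgroup.map_commutator]
  have h1 : (derivedSeries G (m + 1)).map (QuotientGroup.mk' (fittingSeries G i)) = ⊥ := by
    rw [Subgroup.map_eq_bot_iff, QuotientGroup.ker_mk']
    exact h
  rw [← derivedSeries_succ, h1]
  exact bot_le

theorem exists_fittingSeries_eq_top (hG : Group.IsSolvable G) : ∃ n, fittingSeries G n = ⊤ := by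
  obtain ⟨n, hn⟩ := hG.solvable
  have key : ∀ i m, m + i = n → derivedSeries G m ≤ fittingSeries G i := by
    intro i
    induction i with
    | zero => intro m hm; rw [show m = n by omega, hn]; exact bot_le
    | succ i ih => exact fun m hm => derivedSeries_le_fittingSeries_succ (ih (m + 1) (by omega))
  exact ⟨n, top_le_iff.1 (key n 0 (by omega))⟩

/-- The projection `G ⧸ F i → G ⧸ F (i + 1)`. -/
def fittingProj (G : Type u) [Group G] (i : ℕ) :
    G ⧸ fittingSeries G i →* G ⧸ fittingSeries G (i + 1) :=
  QuotientGroup.map _ _ (MonoidHom.id G) (fittingSeries_le_succ i)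

theorem fittingProj_surjective (i : ℕ) : Function.Surjective (fittingProj G i) := fun q => by
  obtain ⟨g, rfl⟩ := QuotientGroup.mk_surjective q
  exact ⟨g, rfl⟩

theorem ker_fittingProj (i : ℕ) :
    (fittingProj G i).ker = fittingSubgroup (G ⧸ fittingSeries G i) := by
  ext q
  obtain ⟨g, rfl⟩ := QuotientGroup.mk_surjective q
  rw [mk_mem_fittingSubgroup_iff, ← QuotientGroup.eq_one_iff (N := fittingSeries G (i + 1))]
  rfl

theorem exists_isDetectingPair_quotient (hfg : Group.FG G) (hsolv : Group.IsSolvable G)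
    (hfit : HasTorsionFreeFittingQuotients G) (i : ℕ)
    (hne : ¬ ∀ a b : G ⧸ fittingSeries G i, Commute a b)
    (ih : (¬ ∀ a b : G ⧸ fittingSeries G (i + 1), Commute a b) →
      ∃ g₁ g₂ : G ⧸ fittingSeries G (i + 1), IsDetectingPair g₁ g₂) :
    ∃ g₁ g₂ : G ⧸ fittingSeries G i, IsDetectingPair g₁ g₂ := by
  have htf := hfit.eq_one_of_isOfFinOrder i
  rcases exists_isDetectingPair_or_commute_fittingSubgroup htf with h | hA
  · exact h
  by_cases hab : ∀ a b : G ⧸ fittingSeries G (i + 1), Commute a b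
  · have hker : commutator (G ⧸ fittingSeries G i) ≤ fittingSubgroup (G ⧸ fittingSeries G i) := by
      rw [commutator_def, Subgroup.commutator_le]
      intro a _ b _
      rw [← ker_fittingProj, MonoidHom.mem_ker, map_commutatorElement]
      exact (hab _ _).commutator_eq
    refine exists_isDetectingPair_of_commutator_le inferInstance hA htf hker ?_ hne
    intro q J hJ hq
    rw [← ker_fittingProj, MonoidHom.mem_ker] at hq ⊢
    refine hfit.eq_one_of_isOfFinOrder (i + 1) _ ?_ (isOfFinOrder_iff_pow_eq_one.2
      ⟨J, hJ, by rw [← map_pow, hq]⟩)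
    -- `G ⧸ F (i + 1)` is abelian, so it is its own Fitting subgroup and is torsion-free.
    refine le_fittingSubgroup (N := ⊤) inferInstance
      (Subgroup.isNilpotent_of_commutator_le_centralizer fun x _ =>
        Subgroup.mem_centralizer_iff.2 fun y _ => hab y x) trivial
  · obtain ⟨q₁, q₂, h⟩ := ih hab
    obtain ⟨g₁, rfl⟩ := fittingProj_surjective i q₁
    obtain ⟨g₂, rfl⟩ := fittingProj_surjective i q₂
    rw [← ker_fittingProj] at hA htf
    refine ⟨g₁, g₂, IsDetectingPair.lift (fittingProj_surjective i) hA htf ?_ h⟩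
    rw [ker_fittingProj]
    exact fun g hg => mem_fittingSubgroup_of_commute inferInstance hg

theorem exists_isDetectingPair (hfg : Group.FG G) (hsolv : Group.IsSolvable G)
    (hfit : HasTorsionFreeFittingQuotients G) (hne : ¬ ∀ a b : G, Commute a b) :
    ∃ g₁ g₂ : G, IsDetectingPair g₁ g₂ := by
  obtain ⟨n, hn⟩ := exists_fittingSeries_eq_top hsolv
  have key : ∀ j i, i + j = n → (¬ ∀ a b : G ⧸ fittingSeries G i, Commute a b) →
      ∃ g₁ g₂ : G ⧸ fittingSeries G i, IsDetectingPair g₁ g₂ := by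
    intro j
    induction j with
    | zero =>
      intro i hi h
      refine absurd (fun a b => ?_) h
      have : Subsingleton (G ⧸ fittingSeries G i) := by
        rw [show i = n by omega, hn]
        exact QuotientGroup.subsingleton_quotient_top
      exact Subsingleton.elim _ _
    | succ j ih =>
      exact fun i hi h => exists_isDetectingPair_quotient hfg hsolv hfit i h (ih (i + 1) (by omega))
  let e : G ⧸ fittingSeries G 0 ≃* G := QuotientGroup.quotientBot
  obtain ⟨g₁, g₂, h⟩ := key n 0 (by omega) fun h => hne fun a b => by
    simpa using (h (e.symm a) (e.symm b)).map e
  exact ⟨_, _, h.map (f := e.toMonoidHom) e.injective⟩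

end FittingSeries

/-! ### From non-foldability to quadratic growth -/

section Growth
variable {G : Type u} [Group G]

theorem exists_edist_schreierGraph_smul_le {S : Set G} (hS : Subgroup.closure S = ⊤) (g : G) :
    ∃ l : ℕ, ∀ (X : Type v) [MulAction G X] (x : X), (schreierGraph S X).edist x (g • x) ≤ l := by
  have hg : g ∈ Subgroup.closure S := by rw [hS]; trivial
  induction hg using Subgroup.closure_induction with
  | mem s hs =>
    refine ⟨1, fun X _ x => ?_⟩
    rw [Nat.cast_one, SimpleGraph.edist_le_one_iff_adj_or_eq]
    by_cases h : x = s • x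
    · exact Or.inr h
    · exact Or.inl ⟨h, Or.inl ⟨s, hs, rfl⟩⟩
  | one => exact ⟨0, fun X _ x => by simp⟩
  | mul g h _ _ hg hh =>
    obtain ⟨l, hl⟩ := hg
    obtain ⟨m, hm⟩ := hh
    refine ⟨m + l, fun X _ x => ?_⟩
    rw [mul_smul, Nat.cast_add]
    exact SimpleGraph.edist_triangle.trans (add_le_add (hm X x) (hl X _))
  | inv g _ hg =>
    obtain ⟨l, hl⟩ := hg
    refine ⟨l, fun X _ x => ?_⟩
    have := hl X (g⁻¹ • x)
    rwa [smul_inv_smul, SimpleGraph.edist_comm] at this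

theorem edist_pow_smul_le {S : Set G} {X : Type v} [MulAction G X] {g : G} {l : ℕ}
    (hl : ∀ x : X, (schreierGraph S X).edist x (g • x) ≤ l) (k : ℕ) (x : X) :
    (schreierGraph S X).edist x (g ^ k • x) ≤ (k * l : ℕ) := by
  induction k generalizing x with
  | zero => simp
  | succ k ih =>
    rw [pow_succ, mul_smul, show (k + 1) * l = l + k * l by ring, Nat.cast_add]
    exact SimpleGraph.edist_triangle.trans (add_le_add (hl x) (ih _))

theorem IsNonFoldablePair.hasSchreierGrowthGap (hfg : Group.FG G) {g₁ g₂ : G}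
    (h : IsNonFoldablePair.{u, v} g₁ g₂) :
    HasSchreierGrowthGap.{u, v} G (fun n => (n : ℝ≥0) ^ 2) := by
  refine ⟨hfg, fun S _ hS X _ _ _ => ?_⟩
  obtain ⟨l₁, h₁⟩ := exists_edist_schreierGraph_smul_le.{u, v} hS g₁
  obtain ⟨l₂, h₂⟩ := exists_edist_schreierGraph_smul_le.{u, v} hS g₂
  -- The extra `1` keeps the constant positive when both word-length bounds vanish.
  refine ⟨l₁ + l₂ + 1, by omega, fun n => ?_⟩
  rcases Nat.eq_zero_or_pos n with rfl | hn
  · simp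
  obtain ⟨x, hx⟩ := h X n hn
  have hball : ∀ i j : ℕ, i ≤ n → j ≤ n →
      (schreierGraph S X).edist x ((g₂ ^ j * g₁ ^ i) • x) ≤ ((l₁ + l₂ + 1) * n : ℕ) := by
    intro i j hi hj
    rw [mul_smul]
    refine SimpleGraph.edist_triangle.trans ((add_le_add (edist_pow_smul_le (h₁ X) i x)
      (edist_pow_smul_le (h₂ X) j _)).trans ?_)
    norm_cast
    nlinarith [Nat.mul_le_mul_right l₁ hi, Nat.mul_le_mul_right l₂ hj]
  have hcard : ((n ^ 2 : ℕ) : ℕ∞) ≤ actionGrowth S X ((l₁ + l₂ + 1) * n) := by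
    refine le_trans ?_ (le_iSup (fun x : X =>
      {y : X | (schreierGraph S X).edist x y ≤ ((l₁ + l₂ + 1) * n : ℕ)}.encard) x)
    let φ : ℕ × ℕ → X := fun p => (g₂ ^ p.2 * g₁ ^ p.1) • x
    have hφ : Set.InjOn φ (Finset.range n ×ˢ Finset.range n : Finset (ℕ × ℕ)) := by
      intro p hp q hq e
      simp only [Finset.coe_product, Finset.coe_range, Set.mem_prod, Set.mem_Iio] at hp hq
      have := @hx (p.1, p.2) (by constructor <;> constructor <;> dsimp only <;> omega)
        (q.1, q.2) (by constructor <;> constructor <;> dsimp only <;> omega)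
        (by simpa [φ] using e)
      simp only [Prod.mk.injEq, Nat.cast_inj] at this
      exact Prod.ext this.1 this.2
    have hc : (φ '' (Finset.range n ×ˢ Finset.range n : Finset (ℕ × ℕ))).encard = (n ^ 2 : ℕ) := by
      rw [hφ.encard_image, Set.encard_coe_eq_coe_finsetCard, Finset.card_product,
        Finset.card_range, sq]
    rw [← hc]
    refine Set.encard_le_encard ?_
    rintro _ ⟨p, hp, rfl⟩
    simp only [Finset.coe_product, Finset.coe_range, Set.mem_prod, Set.mem_Iio] at hp
    exact hball p.1 p.2 hp.1.le hp.2.le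
  have h1 : (((n : ℝ≥0) ^ 2 : ℝ≥0) : ℝ≥0∞) = (((n ^ 2 : ℕ) : ℕ∞) : ℝ≥0∞) := by
    push_cast; rfl
  dsimp only
  rw [h1]
  calc (((n ^ 2 : ℕ) : ℕ∞) : ℝ≥0∞)
      ≤ (actionGrowth S X ((l₁ + l₂ + 1) * n) : ℝ≥0∞) := ENat.toENNReal_le.2 hcard
    _ ≤ _ := le_mul_of_one_le_left zero_le (by exact_mod_cast Nat.le_add_left 1 _)

end Growth

theorem mainTheorem9 (G : Type u) [Group G] (hfg : Group.FG G) (hsolv : Group.IsSolvable G)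
    (hfit : HasTorsionFreeFittingQuotients G) (hva : ¬ IsVirtuallyAbelian G) :
    (∃ g₁ g₂ : G, IsNonFoldablePair.{u, v} g₁ g₂) ∧
      HasSchreierGrowthGap.{u, v} G (fun n => (n : ℝ≥0) ^ 2) := by
  -- Non-commutativity is all that is needed here.
  obtain ⟨g₁, g₂, h⟩ := exists_isDetectingPair hfg hsolv hfit fun h =>
    hva ⟨⊤, inferInstance, fun a _ b _ => h a b⟩
  exact ⟨⟨g₁, g₂, h.isNonFoldablePair⟩, h.isNonFoldablePair.hasSchreierGrowthGap hfg⟩
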